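/- Let $(\mathbf C,\otimes,I,\dagger)$ be a (locally small) dagger compact closed category: a symmetric monoidal category with an identity-on-objects, contravariant, involutive operation $\dagger$ on morphisms such that $(f\otimes g)^\dagger=f^\dagger\otimes g^\dagger$, the associators, unitors and braidings $\beta$ are dagger isomorphisms (isomorphisms $i$ with $i^{-1}=i^\dagger$), and every object $X$ has a dagger dual, i.e. an object $X^*$ and a morphism $\eta_X\colon I\to X^*\otimes X$ that, together with $\varepsilon_X=\eta_X^\dagger\circ\beta_{X,X^*}\colon X\otimes X^*\to I$, satisfies both triangle equations. A morphism $m$ is dagger monic if $m^\dagger\circ m=\mathrm{id}$, and a dagger kernel is a dagger monic kernel $k$ of some morphism; write $k^\perp$ for a dagger monic kernel of $k^\dagger$. Assume that 1. each family of objects, indexed by a set, has a dagger biproduct (an object that is both a product and a coproduct of the family, with projections $p_\alpha$ and injections $i_\alpha$ such that $p_\alpha\circ i_\alpha=\mathrm{id}$, $p_\alpha\circ i_\beta=0$ for $\alpha\ne\beta$, and $p_\alpha=i_\alpha^\dagger$), where the zero morphisms are those that factor through the zero object, the biproduct of the empty family; 2. each morphism has a kernel that is dagger monic; 3. $k$ and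 $k^\perp$ are jointly epic for each dagger kernel $k$; 4. $I$ is not a zero object; 5. each nonzero morphism $I\to I$ is invertible; 6. $I$ is a separator. For a family of morphisms $r_\alpha\colon X\to Y$, $\alpha \in M$, put $\sum_\alpha r_\alpha=\Delta_Y^\dagger\circ\bigl(\bigoplus_\alpha r_\alpha\bigr)\circ\Delta_X$, where $\Delta_X\colon X\to\bigoplus_{\alpha\in M} X$ is the diagonal, and for $r,s\colon X\to Y$ write $r\le s$ if $r+s=s$. For each object $X$ let $E(X)$ be the set of atoms of $\mathbf C(I,X)$ for this order, that is, the set of nonzero $x\colon I\to X$ such that every $b\le x$ is $0$ or $x$. For each $r\colon X\to Y$ let $E(r)=\{(x,y)\in E(X)\times E(Y)\mid y^\dagger\circ r\circ x=\mathrm{id}_I\}$. Then $E$ is a dagger equivalence from $\mathbf C$ to the dagger category $\mathbf{Rel}$ of sets and binary relations (with converse as dagger). That is, $E$ is a functor, $E(r^\dagger)=E(r)^\dagger$ for every morphism $r$, $E$ is full and faithful, and every set is dagger isomorphic in $\mathbf{Rel}$ to $E(X)$ for some object $X$ of $\mathbf C$. Indeed, for every set $M$, if $X$ is any dagger biproduct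 of copies of $I$ indexed by $M$, then $M$ is dagger isomorphic to $E(X)$. -/

import Mathlib

open CategoryTheory CategoryTheory.Limits MonoidalCategory

universe v u

/-- A dagger category: a category with an involutive, identity-on-objects, contravariant
operation on morphisms. -/
class DaggerCategory (C : Type u) [Category.{v} C] where
  /-- The dagger of a morphism. -/
  dagger : ∀ {X Y : C}, (X ⟶ Y) → (Y ⟶ X)
  dagger_id : ∀ X : C, dagger (𝟙 X) = 𝟙 X
  dagger_dagger : ∀ {X Y : C} (f : X ⟶ Y), dagger (dagger f) = f
  dagger_comp : ∀ {X Y Z : C} (f : X ⟶ Y) (g : Y ⟶ Z), dagger (f ≫ g) = dagger g ≫ dagger f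

namespace DaggerCategory

/-! ### Special morphisms in a dagger category -/

section Basic

variable {C : Type u} [Category.{v} C] [DaggerCategory C]

/-- `m` is a dagger monomorphism: `m† ∘ m` is the identity. -/
def IsDaggerMono {X Y : C} (m : X ⟶ Y) : Prop :=
  m ≫ dagger m = 𝟙 X

/-- `i` is a dagger isomorphism: `i†` is a two-sided inverse of `i`. -/
def IsDaggerIso {X Y : C} (i : X ⟶ Y) : Prop :=
  i ≫ dagger i = 𝟙 X ∧ dagger i ≫ i = 𝟙 Y

/-- `f` and `g` are jointly epic. -/
def JointlyEpic {A B X : C} (f : A ⟶ X) (g : B ⟶ X) : Prop :=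
  ∀ ⦃Z : C⦄ (r s : X ⟶ Z), f ≫ r = f ≫ s → g ≫ r = g ≫ s → r = s

variable [HasZeroMorphisms C]

/-- `k` is a kernel of `f`. -/
def IsKernelOf {K X Y : C} (k : K ⟶ X) (f : X ⟶ Y) : Prop :=
  ∃ w : k ≫ f = 0, Nonempty (IsLimit (KernelFork.ofι k w))

/-- `k` is a dagger kernel: it is a dagger monomorphism and a kernel of some morphism. -/
def IsDaggerKernel {K X : C} (k : K ⟶ X) : Prop :=
  IsDaggerMono k ∧ ∃ (Y : C) (f : X ⟶ Y), IsKernelOf k f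

/-- `k'` is (a representative of) the complement `k^⊥ = ker (k†)`, as a dagger kernel. -/
def IsComplementOf {K' K X : C} (k' : K' ⟶ X) (k : K ⟶ X) : Prop :=
  IsDaggerMono k' ∧ IsKernelOf k' (dagger k)

end Basic

/-! ### Dagger biproducts and sums of morphisms -/

/-- A dagger biproduct of the family `F`: an object that is a product and a coproduct of the
family, with `p_j ∘ i_j = id`, with `p_k ∘ i_j = 0` for `j ≠ k`, and with `p_j = i_j†`. -/
structure DaggerBiproduct {C : Type u} [Category.{v} C] [DaggerCategory C] [HasZeroMorphisms C]
    {J : Type v} (F : J → C) where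
  /-- The object, the projections `π` and the injections `ι`. -/
  bicone : Bicone F
  /-- It is both a product and a coproduct. -/
  isBilimit : bicone.IsBilimit
  dagger_ι : ∀ j, dagger (bicone.ι j) = bicone.π j

/-- Every (small) family of objects has a dagger biproduct. -/
class HasDaggerBiproducts (C : Type u) [Category.{v} C] [DaggerCategory C]
    [HasZeroMorphisms C] : Prop where
  exists_biproduct : ∀ {J : Type v} (F : J → C), Nonempty (DaggerBiproduct F)

section Sums

variable {C : Type u} [Category.{v} C] [DaggerCategory C] [HasZeroMorphisms C]

namespace DaggerBiproduct

/-- The underlying object of a dagger biproduct. -/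
abbrev pt {J : Type v} {F : J → C} (A : DaggerBiproduct F) : C :=
  A.bicone.pt

/-- The diagonal morphism `Δ : X ⟶ ⨁_{j ∈ J} X`. -/
def diag {J : Type v} {X : C} (A : DaggerBiproduct (fun _ : J => X)) : X ⟶ A.pt :=
  A.isBilimit.isLimit.lift (Fan.mk X fun _ => 𝟙 X)

/-- The morphism `⨁ r_j : ⨁ F_j ⟶ ⨁ G_j`. -/
def map {J : Type v} {F G : J → C} (A : DaggerBiproduct F) (B : DaggerBiproduct G)
    (r : ∀ j, F j ⟶ G j) : A.pt ⟶ B.pt :=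
  B.isBilimit.isLimit.lift (Fan.mk A.pt fun j => A.bicone.π j ≫ r j)

end DaggerBiproduct

variable [HasDaggerBiproducts C]

/-- A chosen dagger biproduct of a family. -/
noncomputable def chosenBiproduct {J : Type v} (F : J → C) : DaggerBiproduct F :=
  Classical.choice (HasDaggerBiproducts.exists_biproduct F)

/-- The sum `∑ r_j = Δ† ∘ (⨁ r_j) ∘ Δ` of a family of morphisms `X ⟶ Y`. -/
noncomputable def homSum {J : Type v} {X Y : C} (r : J → (X ⟶ Y)) : X ⟶ Y :=
  (chosenBiproduct fun _ : J => X).diag ≫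
    (chosenBiproduct fun _ : J => X).map (chosenBiproduct fun _ : J => Y) r ≫
      dagger (chosenBiproduct fun _ : J => Y).diag

/-- The sum `r + s` of two parallel morphisms. -/
noncomputable def homAdd {X Y : C} (r s : X ⟶ Y) : X ⟶ Y :=
  homSum fun j : ULift.{v} Bool => bif j.down then r else s

/-- The order on morphisms `X ⟶ Y`: `r ≤ s` if `r + s = s`. -/
def HomLE {X Y : C} (r s : X ⟶ Y) : Prop :=
  homAdd r s = s

/-- `a` is an atom of the hom-set for the order `HomLE`, whose least element is `0`. -/
def IsHomAtom {X Y : C} (a : X ⟶ Y) : Prop :=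
  a ≠ 0 ∧ ∀ b : X ⟶ Y, HomLE b a → b = 0 ∨ b = a

end Sums

/-! ### Dagger compact closed categories -/

/-- Compatibility of the dagger with a symmetric monoidal structure: the monoidal product is a
dagger functor, and the associators, unitors and braidings are dagger isomorphisms. -/
class DaggerSymmetric (C : Type u) [Category.{v} C] [MonoidalCategory C] [SymmetricCategory C]
    [DaggerCategory C] : Prop where
  dagger_tensor : ∀ {X₁ Y₁ X₂ Y₂ : C} (f : X₁ ⟶ Y₁) (g : X₂ ⟶ Y₂),
    dagger (f ⊗ₘ g) = dagger f ⊗ₘ dagger g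
  dagger_associator : ∀ X Y Z : C, dagger (α_ X Y Z).hom = (α_ X Y Z).inv
  dagger_leftUnitor : ∀ X : C, dagger (λ_ X).hom = (λ_ X).inv
  dagger_rightUnitor : ∀ X : C, dagger (ρ_ X).hom = (ρ_ X).inv
  dagger_braiding : ∀ X Y : C, dagger (β_ X Y).hom = (β_ X Y).inv

/-- A dagger compact closed category: a dagger symmetric monoidal category in which every object
`X` has a dagger dual, that is, an object `X'` and a morphism `η : I ⟶ X' ⊗ X` that satisfies both
triangle equations together with the counit `ε = η† ∘ β_{X,X'} : X ⊗ X' ⟶ I`. -/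
class DaggerCompactClosed (C : Type u) [Category.{v} C] [MonoidalCategory C]
    [SymmetricCategory C] [DaggerCategory C] : Prop extends DaggerSymmetric C where
  exists_daggerDual : ∀ X : C, ∃ (X' : C) (_ : ExactPairing X' X),
    ε_ X' X = (β_ X X').hom ≫ dagger (η_ X' X)

/-! ### The dagger category of sets and relations; dagger equivalences -/

/-- In the category of sets and relations, the dagger is the converse relation. -/
instance instRelCat : DaggerCategory RelCat.{v} where
  dagger r := RelCat.Hom.ofRel r.rel.inv
  dagger_id X := by
    apply RelCat.Hom.ext
    ext ⟨a, b⟩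
    exact eq_comm
  dagger_dagger _ := rfl
  dagger_comp f g := by
    apply RelCat.Hom.ext
    ext ⟨a, b⟩
    exact exists_congr fun _ => and_comm

/-- A dagger equivalence: a full and faithful functor that preserves the dagger, such that every
object of the target is dagger isomorphic to the image of some object. -/
structure IsDaggerEquivalence {C : Type*} [Category* C] [DaggerCategory C] {D : Type*}
    [Category* D] [DaggerCategory D] (F : C ⥤ D) : Prop where
  full : F.Full
  faithful : F.Faithful
  map_dagger : ∀ {X Y : C} (f : X ⟶ Y), F.map (dagger f) = dagger (F.map f)
  exists_daggerIso : ∀ M : D, ∃ (X : C) (i : M ⟶ F.obj X), IsDaggerIso i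

/-! ### The atoms of an object -/

section Atoms

variable (C : Type u) [Category.{v} C] [MonoidalCategory C] [DaggerCategory C]
  [HasZeroMorphisms C] [HasDaggerBiproducts C]

/-- The data of `E` on objects and on morphisms: `E(X)` is the set of atoms of `C(I, X)`, and
`E(r) = {(x, y) | y† ∘ r ∘ x = 1}`. No functoriality is claimed here. -/
def atomPrefunctor : C ⥤q RelCat.{v} where
  obj X := ({x : 𝟙_ C ⟶ X // IsHomAtom x} : Type v)
  map {X Y} r := RelCat.Hom.ofRel
    {p : {x : 𝟙_ C ⟶ X // IsHomAtom x} × {y : 𝟙_ C ⟶ Y // IsHomAtom y} |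
      p.1.1 ≫ r ≫ dagger p.2.1 = 𝟙 (𝟙_ C)}

end Atoms

end DaggerCategory

/-! Infinite biproducts make sums of arbitrary families available, and an Eilenberg swindle shows
that a sum vanishes only if every term does (`homSum_eq_zero_iff`). With invertibility of nonzero
scalars this leaves only the scalars `0` and `1` (`scalar_eq_id`). Call states `x` and `z`
orthogonal if `x ≫ dagger z = 0`. As the unit separates, a state is determined by the states
orthogonal to it, and `x ≤ y` means that whatever is orthogonal to `y` is orthogonal to `x`
(`homLE_iff`). Dagger kernels supply complements (`exists_split_state`), so states behave like the
subsets of a set, except that atoms might be missing.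

Compactness supplies the atoms: endomorphisms of `X` correspond to states of `X' ⊗ X`, so the
identity has a complement `n`. Without atoms, `n` would relate every pair of nonzero states and
hence lie above the identity, which forces `X` to be zero (`id_eq_zero_of_no_atoms`). Consequently
the identity is the sum of the projections onto atoms (`id_eq_homSum_atoms`). Morphisms are then
matrices of Boolean scalars indexed by atoms, that is, relations. -/

namespace DaggerCategory

/-! ### Dagger biproducts and infinite sums of morphisms. -/

section DaggerSums

variable {C : Type u} [Category.{v} C] [DaggerCategory C] [HasZeroMorphisms C]

@[simp]
theorem dagger_zero (X Y : C) : dagger (0 : X ⟶ Y) = 0 := by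
  rw [← zero_comp (X := X) (f := dagger (0 : Y ⟶ X)), dagger_comp, dagger_dagger, zero_comp]

theorem dagger_eq_zero_iff {X Y : C} (f : X ⟶ Y) : dagger f = 0 ↔ f = 0 := by
  refine ⟨fun h => ?_, fun h => by rw [h, dagger_zero]⟩
  rw [← dagger_dagger f, h, dagger_zero]

theorem comp_dagger_eq_zero_comm {X Y Z : C} {f : X ⟶ Y} {g : Z ⟶ Y} :
    f ≫ dagger g = 0 ↔ g ≫ dagger f = 0 := by
  rw [← dagger_eq_zero_iff, dagger_comp, dagger_dagger]

namespace DaggerBiproduct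

variable {J : Type v} {F : J → C} (A : DaggerBiproduct F)

theorem hom_ext_π {X : C} {f g : X ⟶ A.pt} (h : ∀ j, f ≫ A.bicone.π j = g ≫ A.bicone.π j) :
    f = g :=
  A.isBilimit.isLimit.hom_ext fun j => h j.as

theorem hom_ext_ι {X : C} {f g : A.pt ⟶ X} (h : ∀ j, A.bicone.ι j ≫ f = A.bicone.ι j ≫ g) :
    f = g :=
  A.isBilimit.isColimit.hom_ext fun j => h j.as

theorem dagger_π (j : J) : dagger (A.bicone.π j) = A.bicone.ι j := by
  rw [← A.dagger_ι, dagger_dagger]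

theorem exists_lift {X : C} (r : ∀ j, X ⟶ F j) :
    ∃ u : X ⟶ A.pt, ∀ j, u ≫ A.bicone.π j = r j :=
  ⟨A.isBilimit.isLimit.lift (Fan.mk X r), fun j => A.isBilimit.isLimit.fac _ ⟨j⟩⟩

theorem map_π {G : J → C} (B : DaggerBiproduct G) (r : ∀ j, F j ⟶ G j) (j : J) :
    A.map B r ≫ B.bicone.π j = A.bicone.π j ≫ r j :=
  B.isBilimit.isLimit.fac _ ⟨j⟩

theorem ι_map {G : J → C} (B : DaggerBiproduct G) (r : ∀ j, F j ⟶ G j) (j : J) :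
    A.bicone.ι j ≫ A.map B r = r j ≫ B.bicone.ι j := by
  refine B.hom_ext_π fun k => ?_
  rw [Category.assoc, Category.assoc, map_π]
  by_cases h : j = k
  · subst h; simp
  · rw [bicone_ι_π_ne_assoc _ h, bicone_ι_π_ne _ h, zero_comp, comp_zero]

theorem exists_comp_dagger_ι_ne_zero {X : C} {x : X ⟶ A.pt} (hx : x ≠ 0) :
    ∃ j, x ≫ dagger (A.bicone.ι j) ≠ 0 := by
  by_contra! h
  refine hx (A.hom_ext_π fun j => ?_)
  rw [← A.dagger_ι, h, zero_comp]

variable {X : C} (D : DaggerBiproduct fun _ : J => X)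

theorem diag_π (j : J) : D.diag ≫ D.bicone.π j = 𝟙 X :=
  D.isBilimit.isLimit.fac _ ⟨j⟩

theorem ι_dagger_diag (j : J) : D.bicone.ι j ≫ dagger D.diag = 𝟙 X := by
  rw [← D.dagger_π, ← dagger_comp, diag_π, dagger_id]

end DaggerBiproduct

variable [HasDaggerBiproducts C] {X Y Z : C} {J K : Type v}

theorem homSum_eq_comp_dagger_diag {r : J → (X ⟶ Y)}
    (u : X ⟶ (chosenBiproduct fun _ : J => Y).pt)
    (hu : ∀ j, u ≫ (chosenBiproduct fun _ : J => Y).bicone.π j = r j) :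
    homSum r = u ≫ dagger (chosenBiproduct fun _ : J => Y).diag := by
  rw [homSum, ← Category.assoc]
  congr 1
  refine DaggerBiproduct.hom_ext_π _ fun j => ?_
  rw [hu, Category.assoc, DaggerBiproduct.map_π, ← Category.assoc, DaggerBiproduct.diag_π,
    Category.id_comp]

theorem homSum_eq_diag_comp {r : J → (X ⟶ Y)}
    (t : (chosenBiproduct fun _ : J => X).pt ⟶ Y)
    (ht : ∀ j, (chosenBiproduct fun _ : J => X).bicone.ι j ≫ t = r j) :
    homSum r = (chosenBiproduct fun _ : J => X).diag ≫ t := by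
  rw [homSum]
  congr 1
  refine DaggerBiproduct.hom_ext_ι _ fun j => ?_
  rw [ht, ← Category.assoc, DaggerBiproduct.ι_map, Category.assoc, DaggerBiproduct.ι_dagger_diag,
    Category.comp_id]

theorem comp_homSum (f : X ⟶ Y) (r : J → (Y ⟶ Z)) :
    f ≫ homSum r = homSum fun j => f ≫ r j := by
  obtain ⟨u, hu⟩ := (chosenBiproduct fun _ : J => Z).exists_lift r
  rw [homSum_eq_comp_dagger_diag u hu, homSum_eq_comp_dagger_diag (f ≫ u) fun j => by
    rw [Category.assoc, hu], Category.assoc]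

theorem homSum_comp (r : J → (X ⟶ Y)) (g : Y ⟶ Z) :
    homSum r ≫ g = homSum fun j => r j ≫ g := by
  have ht : ∀ j, (chosenBiproduct fun _ : J => X).bicone.ι j ≫
      (chosenBiproduct fun _ : J => X).map (chosenBiproduct fun _ : J => Y) r ≫
        dagger (chosenBiproduct fun _ : J => Y).diag = r j := fun j => by
    rw [← Category.assoc, DaggerBiproduct.ι_map, Category.assoc, DaggerBiproduct.ι_dagger_diag,
      Category.comp_id]
  rw [homSum_eq_diag_comp _ ht, homSum_eq_diag_comp (_ ≫ g) fun j => by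
    rw [← Category.assoc, ht], Category.assoc]

/-- Each row `m j` is assembled into one morphism `t j` to a biproduct; the components of `∑ t j`
are the column sums. -/
theorem homSum_homSum_comm (m : J → K → (X ⟶ Y)) :
    (homSum fun j => homSum (m j)) = homSum fun k => homSum fun j => m j k := by
  choose t ht using fun j => (chosenBiproduct fun _ : K => Y).exists_lift (m j)
  rw [homSum_eq_comp_dagger_diag (J := K) (homSum t) fun k => by
    rw [homSum_comp]; simp only [ht], homSum_comp]
  congr 1
  funext j
  rw [homSum_eq_comp_dagger_diag (t j) (ht j)]

theorem homSum_eq_single {r : J → (X ⟶ Y)} (k : J) (h : ∀ j, j ≠ k → r j = 0) :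
    homSum r = r k := by
  rw [homSum_eq_comp_dagger_diag (r k ≫ (chosenBiproduct fun _ : J => Y).bicone.ι k) fun j => ?_,
    Category.assoc, DaggerBiproduct.ι_dagger_diag, Category.comp_id]
  by_cases hj : j = k
  · subst hj; simp
  · rw [Category.assoc, bicone_ι_π_ne _ (Ne.symm hj), comp_zero, h j hj]

theorem homSum_zero : homSum (fun _ : J => (0 : X ⟶ Y)) = 0 := by
  rw [homSum_eq_comp_dagger_diag 0 fun j => zero_comp, zero_comp]

/-- Interchange of sums, applied to the matrix whose only possibly nonzero entries are `r (e j)` in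
position `(j, e j)`. -/
theorem homSum_equiv (e : J ≃ K) (r : K → (X ⟶ Y)) :
    (homSum fun j => r (e j)) = homSum r := by
  classical
  have h := homSum_homSum_comm fun j k => if k = e j then r k else 0
  have h₁ : ∀ j, (homSum fun k => if k = e j then r k else 0) = r (e j) := fun j => by
    rw [homSum_eq_single (e j) fun k hk => if_neg hk, if_pos rfl]
  have h₂ : ∀ k, (homSum fun j => if k = e j then r k else 0) = r k := fun k => by
    rw [homSum_eq_single (e.symm k) fun j hj => if_neg fun hk => hj (by simp [hk]),
      if_pos (by simp)]
  simpa only [h₁, h₂] using h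

theorem comp_homAdd (f : X ⟶ Y) (r s : Y ⟶ Z) :
    f ≫ homAdd r s = homAdd (f ≫ r) (f ≫ s) := by
  rw [homAdd, comp_homSum, homAdd]
  congr 1
  funext ⟨j⟩
  cases j <;> rfl

theorem homAdd_comp (r s : X ⟶ Y) (g : Y ⟶ Z) :
    homAdd r s ≫ g = homAdd (r ≫ g) (s ≫ g) := by
  rw [homAdd, homSum_comp, homAdd]
  congr 1
  funext ⟨j⟩
  cases j <;> rfl

@[simp]
theorem homAdd_zero (r : X ⟶ Y) : homAdd r 0 = r := by
  rw [homAdd, homSum_eq_single ⟨true⟩]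
  · rfl
  · rintro ⟨_ | _⟩ h
    · rfl
    · exact absurd rfl h

@[simp]
theorem zero_homAdd (r : X ⟶ Y) : homAdd 0 r = r := by
  rw [homAdd, homSum_eq_single ⟨false⟩]
  · rfl
  · rintro ⟨_ | _⟩ h
    · exact absurd rfl h
    · rfl

theorem homSum_homAdd (r s : J → (X ⟶ Y)) :
    (homSum fun j => homAdd (r j) (s j)) = homAdd (homSum r) (homSum s) := by
  unfold homAdd
  rw [homSum_homSum_comm]
  congr 1
  funext ⟨j⟩
  cases j <;> rfl

theorem HomLE.comp {x y : Z ⟶ X} (h : HomLE x y) (f : X ⟶ Y) : HomLE (x ≫ f) (y ≫ f) := by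
  rw [HomLE, ← homAdd_comp, h]

theorem homSum_eq_homAdd {r : J → (X ⟶ Y)} {k l : J} (hkl : k ≠ l)
    (h : ∀ j, j ≠ k → j ≠ l → r j = 0) : homSum r = homAdd (r k) (r l) := by
  classical
  have e : r = fun j => homAdd (if j = k then r j else 0) (if j = l then r j else 0) := by
    funext j
    by_cases hk : j = k
    · subst hk; simp [hkl]
    · by_cases hl : j = l
      · subst hl; simp [hk]
      · simp [hk, hl, h j hk hl]
  conv_lhs => rw [e]
  rw [homSum_homAdd, homSum_eq_single k fun j hj => if_neg hj,
    homSum_eq_single l fun j hj => if_neg hj, if_pos rfl, if_pos rfl]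

theorem homAdd_comm (r s : X ⟶ Y) : homAdd r s = homAdd s r := by
  rw [homAdd, homSum_eq_homAdd (k := ⟨false⟩) (l := ⟨true⟩) (by simp)
    (by rintro ⟨_ | _⟩ h h' <;> simp at h h')]
  rfl

/-- An Eilenberg swindle: hom-sets of a category with infinite biproducts are zero-sum-free. -/
theorem eq_zero_of_homAdd_eq_zero {a b : X ⟶ Y} (h : homAdd a b = 0) : a = 0 := by
  classical
  -- With `a` on the diagonal and `b` just right of it, every row and every column but column `0`
  -- sums to `a + b = 0`; column `0` sums to `a`.
  let m : ULift.{v} ℕ → ULift.{v} ℕ → (X ⟶ Y) := fun n k =>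
    if k.down = n.down then a else if k.down = n.down + 1 then b else 0
  have hr : ∀ n, homSum (m n) = 0 := by
    rintro ⟨n⟩
    rw [homSum_eq_homAdd (k := ⟨n⟩) (l := ⟨n + 1⟩)]
    · simpa [m] using h
    · intro e
      have := congrArg ULift.down e
      simp at this
    · rintro ⟨j⟩ h₁ h₂
      have h₁' : j ≠ n := fun e => h₁ (ULift.ext _ _ e)
      have h₂' : j ≠ n + 1 := fun e => h₂ (ULift.ext _ _ e)
      simp [m, h₁', h₂']
  have hc : ∀ k : ULift.{v} ℕ, (homSum fun n => m n k) = if k.down = 0 then a else 0 := by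
    rintro ⟨_ | k⟩
    · rw [homSum_eq_single ⟨0⟩]
      · simp [m]
      · rintro ⟨n⟩ hn
        have : (0 : ℕ) ≠ n := fun e => hn (ULift.ext _ _ e.symm)
        simp [m, this]
    · rw [homSum_eq_homAdd (k := ⟨k + 1⟩) (l := ⟨k⟩)]
      · simpa [m] using h
      · intro e
        have := congrArg ULift.down e
        simp at this
      · rintro ⟨j⟩ h₁ h₂
        have h₁' : k + 1 ≠ j := fun e => h₁ (ULift.ext _ _ e.symm)
        have h₂' : k ≠ j := fun e => h₂ (ULift.ext _ _ e.symm)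
        simp [m, h₁', h₂']
  have := homSum_homSum_comm m
  simp only [hr, hc] at this
  rw [homSum_zero, homSum_eq_single ⟨0⟩ fun n hn => if_neg fun e => hn (ULift.ext _ _ e)] at this
  simpa using this.symm

theorem homSum_eq_zero_iff {r : J → (X ⟶ Y)} : homSum r = 0 ↔ ∀ j, r j = 0 := by
  classical
  refine ⟨fun h k => ?_, fun h => ?_⟩
  · have e : r = fun j => homAdd (if j = k then r j else 0) (if j = k then 0 else r j) := by
      funext j
      by_cases hk : j = k <;> simp [hk]
    rw [e, homSum_homAdd, homSum_eq_single k fun j hj => if_neg hj, if_pos rfl] at h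
    exact eq_zero_of_homAdd_eq_zero h
  · rw [funext h]
    exact homSum_zero

theorem homAdd_eq_zero_iff {r s : X ⟶ Y} : homAdd r s = 0 ↔ r = 0 ∧ s = 0 := by
  refine ⟨fun h => ⟨eq_zero_of_homAdd_eq_zero h, eq_zero_of_homAdd_eq_zero (a := s) (b := r) ?_⟩, ?_⟩
  · rwa [homAdd_comm]
  · rintro ⟨rfl, rfl⟩
    exact homAdd_zero 0

/-- Functors with a right adjoint preserve sums of morphisms. -/
theorem map_homSum_of_isLeftAdjoint {D : Type*} [Category.{v} D] [DaggerCategory D]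
    [HasZeroMorphisms D] [HasDaggerBiproducts D] (F : C ⥤ D) [F.IsLeftAdjoint]
    (r : J → (X ⟶ Y)) : F.map (homSum r) = homSum fun j => F.map (r j) := by
  let B := chosenBiproduct fun _ : J => Y
  -- Transposing along the adjunction moves the source from `F.obj B.pt` back to `B.pt`, where
  -- equality can be tested on the injections.
  have key : F.map (dagger B.diag) = homSum fun j => F.map (B.bicone.π j) := by
    apply ((Adjunction.ofIsLeftAdjoint F).homEquiv _ _).injective
    refine B.hom_ext_ι fun k => ?_
    rw [← Adjunction.homEquiv_naturality_left, ← Adjunction.homEquiv_naturality_left,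
      ← F.map_comp, B.ι_dagger_diag, comp_homSum, homSum_eq_single k]
    · rw [← F.map_comp, bicone_ι_π_self]
    · intro j hj
      rw [← F.map_comp, bicone_ι_π_ne _ hj.symm, F.map_zero]
  obtain ⟨u, hu⟩ := B.exists_lift r
  rw [homSum_eq_comp_dagger_diag u hu, F.map_comp, key, comp_homSum]
  simp only [← F.map_comp, hu]

theorem map_homAdd_of_isLeftAdjoint {D : Type*} [Category.{v} D] [DaggerCategory D]
    [HasZeroMorphisms D] [HasDaggerBiproducts D] (F : C ⥤ D) [F.IsLeftAdjoint]
    (r s : X ⟶ Y) : F.map (homAdd r s) = homAdd (F.map r) (F.map s) := by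
  rw [homAdd, map_homSum_of_isLeftAdjoint, homAdd]
  congr 1
  funext ⟨j⟩
  cases j <;> rfl

end DaggerSums

end DaggerCategory

namespace DaggerCategory

/-- The axioms on dagger kernels and on the monoidal unit that characterize the dagger category of
sets and relations among dagger compact closed categories with small dagger biproducts. -/
class IsRelLike (C : Type u) [Category.{v} C] [MonoidalCategory C] [DaggerCategory C]
    [HasZeroMorphisms C] : Prop where
  exists_kernel : ∀ {X Y : C} (f : X ⟶ Y), ∃ (K : C) (k : K ⟶ X), IsKernelOf k f ∧ IsDaggerMono k
  jointlyEpic : ∀ {K K' X : C} (k : K ⟶ X) (k' : K' ⟶ X), IsDaggerKernel k →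
    IsComplementOf k' k → JointlyEpic k k'
  unit_nonzero : ¬ IsZero (𝟙_ C)
  isIso_of_ne_zero : ∀ f : 𝟙_ C ⟶ 𝟙_ C, f ≠ 0 → IsIso f
  unit_separator : IsSeparator (𝟙_ C)

/-! ### Dagger kernels and atoms. -/

section Kernels

variable {C : Type u} [Category.{v} C] [HasZeroMorphisms C]

theorem IsKernelOf.exists_fac {K X Y W : C} {k : K ⟶ X} {f : X ⟶ Y} (hk : IsKernelOf k f)
    (g : W ⟶ X) (hg : g ≫ f = 0) : ∃ a : W ⟶ K, a ≫ k = g := by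
  obtain ⟨w, ⟨l⟩⟩ := hk
  exact ⟨l.lift (KernelFork.ofι g hg), l.fac _ WalkingParallelPair.zero⟩

/-- Atoms of a dagger kernel are atoms of the ambient object. -/
theorem IsHomAtom.comp_kernel [DaggerCategory C] [HasDaggerBiproducts C]
    {W K X Z : C} {a : W ⟶ K} (ha : IsHomAtom a)
    {k : K ⟶ X} {f : X ⟶ Z} (hk : IsKernelOf k f) (hm : IsDaggerMono k) : IsHomAtom (a ≫ k) := by
  have hkk {Y : C} (b : Y ⟶ K) : (b ≫ k) ≫ dagger k = b := by
    rw [Category.assoc, hm, Category.comp_id]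
  refine ⟨fun h => ha.1 (by rw [← hkk a, h, zero_comp]), fun b hb => ?_⟩
  have hb₀ : b ≫ f = 0 := by
    have h := hb.comp f
    rwa [Category.assoc, hk.1, comp_zero, HomLE, homAdd_zero] at h
  obtain ⟨c, rfl⟩ := hk.exists_fac b hb₀
  have hc := hb.comp (dagger k)
  rw [hkk, hkk] at hc
  rcases ha.2 c hc with rfl | rfl
  · exact Or.inl zero_comp
  · exact Or.inr rfl

end Kernels

/-! ### States, their orthogonality and their order. -/

section States

variable {C : Type u} [Category.{v} C] [MonoidalCategory C] [DaggerCategory C]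
  [HasZeroMorphisms C] [IsRelLike C] {X Y : C}

theorem id_unit_ne_zero : 𝟙 (𝟙_ C) ≠ 0 := fun h =>
  IsRelLike.unit_nonzero ((IsZero.iff_id_eq_zero _).2 h)

theorem hom_ext_states {f g : X ⟶ Y} (h : ∀ x : 𝟙_ C ⟶ X, x ≫ f = x ≫ g) : f = g :=
  (isSeparator_def _).1 IsRelLike.unit_separator _ _ h

/-- A nonzero state is not orthogonal to itself. -/
theorem eq_zero_of_comp_dagger_self {x : 𝟙_ C ⟶ X} (h : x ≫ dagger x = 0) : x = 0 := by
  obtain ⟨K, k, hk, hm⟩ := IsRelLike.exists_kernel (dagger x)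
  obtain ⟨a, rfl⟩ := hk.exists_fac x h
  have h₀ : k ≫ dagger (a ≫ k) = 0 := hk.1
  -- The state lies in its own orthogonal complement `k`, so its coordinate `a` there is zero.
  rw [comp_dagger_eq_zero_comm, Category.assoc, hm, Category.comp_id] at h₀
  rw [h₀, zero_comp]

theorem comp_dagger_self_ne_zero {x : 𝟙_ C ⟶ X} (h : x ≠ 0) : x ≫ dagger x ≠ 0 :=
  fun h' => h (eq_zero_of_comp_dagger_self h')

theorem DaggerBiproduct.ι_comp_dagger_ι_ne_zero_iff {M : Type v}
    (A : DaggerBiproduct fun _ : M => 𝟙_ C) {j k : M} :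
    A.bicone.ι j ≫ dagger (A.bicone.ι k) ≠ 0 ↔ j = k := by
  rw [A.dagger_ι]
  constructor
  · exact fun h => not_not.1 fun hjk => h (bicone_ι_π_ne _ hjk)
  · rintro rfl
    rw [bicone_ι_π_self]
    exact id_unit_ne_zero

variable [HasDaggerBiproducts C]

/-- The only scalars are `0` and `1`: every unit fixes the sum of all scalars, which is a unit. -/
theorem scalar_eq_id {s : 𝟙_ C ⟶ 𝟙_ C} (hs : s ≠ 0) : s = 𝟙 (𝟙_ C) := by
  have := IsRelLike.isIso_of_ne_zero s hs
  have hT : homSum (fun t : 𝟙_ C ⟶ 𝟙_ C => t) ≠ 0 := fun h =>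
    id_unit_ne_zero (homSum_eq_zero_iff.1 h (𝟙 _))
  have := IsRelLike.isIso_of_ne_zero _ hT
  have h : s ≫ homSum (fun t : 𝟙_ C ⟶ 𝟙_ C => t) = homSum fun t => t := by
    rw [comp_homSum]
    exact homSum_equiv (asIso s).symm.homFromEquiv fun t => t
  rw [← cancel_mono (homSum fun t : 𝟙_ C ⟶ 𝟙_ C => t), h, Category.id_comp]

theorem scalar_eq_id_iff {s : 𝟙_ C ⟶ 𝟙_ C} : s = 𝟙 (𝟙_ C) ↔ s ≠ 0 :=
  ⟨fun h => h ▸ id_unit_ne_zero, scalar_eq_id⟩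

theorem scalar_ext {s t : 𝟙_ C ⟶ 𝟙_ C} (h : s = 0 ↔ t = 0) : s = t := by
  by_cases hs : s = 0
  · rw [hs, h.1 hs]
  · rw [scalar_eq_id hs, scalar_eq_id fun ht => hs (h.2 ht)]

theorem state_ext {x y : 𝟙_ C ⟶ X} (h : ∀ z : 𝟙_ C ⟶ X, x ≫ dagger z = 0 ↔ y ≫ dagger z = 0) :
    x = y := by
  rw [← dagger_dagger x, ← dagger_dagger y]
  congr 1
  refine hom_ext_states fun z => scalar_ext ?_
  rw [comp_dagger_eq_zero_comm, h, comp_dagger_eq_zero_comm]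

/-- A sum of scalars vanishes only termwise, so a state is orthogonal to `x + y` exactly when it is
orthogonal to both. This turns the order into a statement about orthogonality. -/
theorem homLE_iff {x y : 𝟙_ C ⟶ X} :
    HomLE x y ↔ ∀ z : 𝟙_ C ⟶ X, x ≫ dagger z ≠ 0 → y ≫ dagger z ≠ 0 := by
  constructor
  · intro h z hz hy
    rw [HomLE] at h
    rw [← h, homAdd_comp, homAdd_eq_zero_iff] at hy
    exact hz hy.1
  · intro h
    refine state_ext fun z => ?_
    rw [homAdd_comp, homAdd_eq_zero_iff]
    exact ⟨fun hz => hz.2, fun hz => ⟨not_not.1 fun hx => h z hx hz, hz⟩⟩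

theorem homLE_antisymm {x y : 𝟙_ C ⟶ X} (h : HomLE x y) (h' : HomLE y x) : x = y :=
  state_ext fun z => not_iff_not.1 ⟨homLE_iff.1 h z, homLE_iff.1 h' z⟩

theorem HomLE.trans {x y z : 𝟙_ C ⟶ X} (h : HomLE x y) (h' : HomLE y z) : HomLE x z :=
  homLE_iff.2 fun w hw => homLE_iff.1 h' w (homLE_iff.1 h w hw)

theorem homLE_homSum {J : Type v} (x : J → (𝟙_ C ⟶ X)) (j : J) : HomLE (x j) (homSum x) :=
  homLE_iff.2 fun z hz h => hz (by
    rw [homSum_comp, homSum_eq_zero_iff] at h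
    exact h j)

theorem homLE_homAdd_left (x y : 𝟙_ C ⟶ X) : HomLE x (homAdd x y) :=
  homLE_iff.2 fun z hz h => hz (by
    rw [homAdd_comp, homAdd_eq_zero_iff] at h
    exact h.1)

theorem homLE_homAdd_right (x y : 𝟙_ C ⟶ X) : HomLE y (homAdd x y) := by
  rw [homAdd_comm]
  exact homLE_homAdd_left y x

/-- A dagger kernel and its complement split the identity. -/
theorem exists_dagger_splitting {Z : C} (f : X ⟶ Z) : ∃ (K K' : C) (k : K ⟶ X) (k' : K' ⟶ X),
    IsKernelOf k f ∧ IsDaggerMono k ∧ IsDaggerMono k' ∧ k ≫ dagger k' = 0 ∧ k' ≫ dagger k = 0 ∧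
      homAdd (dagger k ≫ k) (dagger k' ≫ k') = 𝟙 X := by
  obtain ⟨K, k, hk, hm⟩ := IsRelLike.exists_kernel f
  obtain ⟨K', k', hk', hm'⟩ := IsRelLike.exists_kernel (dagger k)
  have h₁ : k' ≫ dagger k = 0 := hk'.1
  have h₂ : k ≫ dagger k' = 0 := comp_dagger_eq_zero_comm.1 h₁
  refine ⟨K, K', k, k', hk, hm, hm', h₂, h₁,
    IsRelLike.jointlyEpic k k' ⟨hm, _, f, hk⟩ ⟨hm', hk'⟩ _ _ ?_ ?_⟩
  · rw [comp_homAdd, ← Category.assoc, hm, ← Category.assoc k, h₂, zero_comp, homAdd_zero,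
      Category.id_comp, Category.comp_id]
  · rw [comp_homAdd, ← Category.assoc, h₁, ← Category.assoc k', hm', zero_comp, zero_homAdd,
      Category.id_comp, Category.comp_id]

/-- Every state is the sum of a state below `z` and a state orthogonal to `z`. -/
theorem exists_split_state (x z : 𝟙_ C ⟶ X) :
    ∃ w w' : 𝟙_ C ⟶ X, homAdd w w' = x ∧ HomLE w z ∧ w' ≫ dagger z = 0 := by
  obtain ⟨K, K', k, k', hk, hm, hm', h₁, h₂, hid⟩ := exists_dagger_splitting (dagger z)
  have hkz : k ≫ dagger z = 0 := hk.1
  refine ⟨x ≫ dagger k' ≫ k', x ≫ dagger k ≫ k, ?_, ?_, ?_⟩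
  · rw [homAdd_comm, ← comp_homAdd, hid, Category.comp_id]
  -- If `y` is orthogonal to `z`, so is its `k'`-component, by zero-sum-freeness. That component
  -- then lies in the kernel `k` as well as in its complement, hence vanishes.
  · refine homLE_iff.2 fun y hy hzy => hy ?_
    rw [comp_dagger_eq_zero_comm, ← Category.comp_id y, ← hid, comp_homAdd, homAdd_comp,
      homAdd_eq_zero_iff] at hzy
    obtain ⟨a, ha⟩ := hk.exists_fac _ hzy.2
    have hv : y ≫ dagger k' = 0 := by
      rw [← Category.comp_id (y ≫ dagger k'), ← show k' ≫ dagger k' = 𝟙 _ from hm',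
        ← Category.assoc, Category.assoc y, ← ha, Category.assoc, h₁, comp_zero]
    rw [Category.assoc, Category.assoc, comp_dagger_eq_zero_comm.1 hv, comp_zero, comp_zero]
  · rw [Category.assoc, Category.assoc, hkz, comp_zero, comp_zero]

/-- The sum of all states is the greatest state; `v` is its part orthogonal to `u`. -/
theorem exists_state_complement (u : 𝟙_ C ⟶ X) :
    ∃ v : 𝟙_ C ⟶ X, v ≫ dagger u = 0 ∧ ∀ z, HomLE z (homAdd u v) := by
  obtain ⟨w, v, hwv, hw, hv⟩ := exists_split_state (homSum fun z : 𝟙_ C ⟶ X => z) u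
  refine ⟨v, hv, fun z => (homLE_homSum (fun z : 𝟙_ C ⟶ X => z) z).trans ?_⟩
  rw [← hwv]
  refine homLE_iff.2 fun y hy => ?_
  rw [Ne, homAdd_comp, homAdd_eq_zero_iff] at hy ⊢
  exact fun h => hy ⟨not_not.1 fun h' => homLE_iff.1 hw y h' h.1, h.2⟩

namespace IsHomAtom

/-- The part of `a` below `z` is `0` or `a`, and `0` would make `a` orthogonal to `z`. -/
theorem homLE {a z : 𝟙_ C ⟶ X} (ha : IsHomAtom a) (h : a ≫ dagger z ≠ 0) : HomLE a z := by
  obtain ⟨w, w', rfl, hw, hw'⟩ := exists_split_state a z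
  rcases ha.2 w (homLE_homAdd_left w w') with h₀ | h₁
  · rw [h₀, zero_homAdd] at h
    exact absurd hw' h
  · rwa [← h₁]

theorem eq_of_comp_dagger_ne_zero {a b : 𝟙_ C ⟶ X} (ha : IsHomAtom a) (hb : IsHomAtom b)
    (h : a ≫ dagger b ≠ 0) : a = b :=
  (hb.2 a (ha.homLE h)).resolve_left ha.1

end IsHomAtom

/-- `b` lies strictly between `0` and `x`, and `c` is the part of `x` orthogonal to `b`; it is
nonzero, as otherwise `x ≤ b`. -/
theorem exists_disjoint_of_not_isHomAtom {x : 𝟙_ C ⟶ X} (hx : x ≠ 0) (h : ¬ IsHomAtom x) :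
    ∃ b c : 𝟙_ C ⟶ X, b ≠ 0 ∧ c ≠ 0 ∧ HomLE b x ∧ HomLE c x ∧ c ≫ dagger b = 0 := by
  simp only [IsHomAtom, not_and, not_forall, not_or] at h
  obtain ⟨b, hb, hb₀, hbx⟩ := h hx
  obtain ⟨w, c, rfl, hw, hc⟩ := exists_split_state x b
  refine ⟨b, c, hb₀, ?_, hb, homLE_homAdd_right w c, hc⟩
  rintro rfl
  rw [homAdd_zero] at hb hbx
  exact hbx (homLE_antisymm hb hw)

theorem mem_atomPrefunctor_map {r : X ⟶ Y} {x : {x : 𝟙_ C ⟶ X // IsHomAtom x}}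
    {y : {y : 𝟙_ C ⟶ Y // IsHomAtom y}} :
    (x, y) ∈ ((atomPrefunctor C).map r).rel ↔ x.1 ≫ r ≫ dagger y.1 ≠ 0 :=
  scalar_eq_id_iff

theorem IsHomAtom.comp_dagger_ne_zero_iff {a b : 𝟙_ C ⟶ X} (ha : IsHomAtom a)
    (hb : IsHomAtom b) : a ≫ dagger b ≠ 0 ↔ a = b :=
  ⟨ha.eq_of_comp_dagger_ne_zero hb, fun h => h ▸ comp_dagger_self_ne_zero ha.1⟩

namespace DaggerBiproduct

variable {M : Type v} (A : DaggerBiproduct fun _ : M => 𝟙_ C)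

theorem isHomAtom_ι (j : M) : IsHomAtom (A.bicone.ι j) := by
  have hj : A.bicone.ι j ≫ dagger (A.bicone.ι j) ≠ 0 := A.ι_comp_dagger_ι_ne_zero_iff.2 rfl
  refine ⟨fun h => hj (by rw [h, zero_comp]), fun b hb => or_iff_not_imp_left.2 fun hb₀ => ?_⟩
  have hb' {k : M} (hk : b ≫ dagger (A.bicone.ι k) ≠ 0) : j = k :=
    A.ι_comp_dagger_ι_ne_zero_iff.1 (homLE_iff.1 hb _ hk)
  refine A.hom_ext_π fun k => scalar_ext ?_
  rw [← A.dagger_ι, ← not_iff_not, ← Ne, ← Ne, A.ι_comp_dagger_ι_ne_zero_iff]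
  refine ⟨hb', ?_⟩
  rintro rfl
  obtain ⟨k, hk⟩ := A.exists_comp_dagger_ι_ne_zero hb₀
  rwa [hb' hk]

/-- The atoms of a dagger biproduct of copies of the unit are the injections. -/
theorem bijective_ι : Function.Bijective fun j : M =>
    (⟨A.bicone.ι j, A.isHomAtom_ι j⟩ : {x : 𝟙_ C ⟶ A.pt // IsHomAtom x}) := by
  constructor
  · intro j k h
    have h' : A.bicone.ι j = A.bicone.ι k := congrArg Subtype.val h
    rw [← A.ι_comp_dagger_ι_ne_zero_iff, ← h']
    exact A.ι_comp_dagger_ι_ne_zero_iff.2 rfl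
  · rintro ⟨a, ha⟩
    obtain ⟨j, hj⟩ := A.exists_comp_dagger_ι_ne_zero ha.1
    exact ⟨j, Subtype.ext (ha.eq_of_comp_dagger_ne_zero (A.isHomAtom_ι j) hj).symm⟩

end DaggerBiproduct

end States

end DaggerCategory

namespace DaggerCategory

/-! ### Compactness and the existence of atoms. -/

section Compact

variable {C : Type u} [Category.{v} C] [MonoidalCategory C] [SymmetricCategory C]
  [DaggerCategory C] [DaggerCompactClosed C] [HasZeroMorphisms C] [HasDaggerBiproducts C]
  [IsRelLike C] {X Y : C}

/-- There is an endomorphism of `X` that, together with the identity, covers all endomorphisms,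
and that does not cover the identity unless `X` is zero. -/
theorem exists_end_complement (X : C) : ∃ n : X ⟶ X,
    (∀ r : X ⟶ X, homAdd r (homAdd (𝟙 X) n) = homAdd (𝟙 X) n) ∧
      (homAdd (𝟙 X) n = n → 𝟙 X = 0) := by
  obtain ⟨X', e, -⟩ := DaggerCompactClosed.exists_daggerDual X
  obtain ⟨X'', e', -⟩ := DaggerCompactClosed.exists_daggerDual X'
  -- The dual of `X'` makes `X' ⊗ -` a left adjoint, so it preserves sums and the bijection `φ`
  -- below is additive. Complements of states thereby become complements of endomorphisms.
  have : (tensorLeft X').IsLeftAdjoint := (tensorLeftAdjunction X'' X').isLeftAdjoint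
  let φ : (X ⟶ X) ≃ (𝟙_ C ⟶ X' ⊗ X) :=
    (ρ_ X).symm.homFromEquiv.trans (tensorLeftHomEquiv (𝟙_ C) X' X X)
  have hφ (r : X ⟶ X) : φ r = φ (𝟙 X) ≫ (tensorLeft X').map r := by
    have := tensorLeftHomEquiv_naturality (Y := X') ((ρ_ X).hom ≫ 𝟙 X) r
    rwa [Category.assoc, Category.id_comp] at this
  have hadd (r s : X ⟶ X) : φ (homAdd r s) = homAdd (φ r) (φ s) := by
    rw [hφ, map_homAdd_of_isLeftAdjoint, comp_homAdd, ← hφ, ← hφ]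
  obtain ⟨v, hv, htop⟩ := exists_state_complement (φ (𝟙 X))
  refine ⟨φ.symm v, fun r => φ.injective ?_, fun h => φ.injective ?_⟩
  · rw [hadd, hadd, φ.apply_symm_apply]
    exact htop _
  · rw [hφ 0, Functor.map_zero, comp_zero]
    have hle : HomLE (φ (𝟙 X)) v := by
      have := congrArg φ h
      rwa [hadd, φ.apply_symm_apply] at this
    exact not_not.1 fun h₀ => homLE_iff.1 hle _ (comp_dagger_self_ne_zero h₀) hv

/-- The complement `n` of the identity relates any two orthogonal nonzero states. Since every
nonzero state contains two orthogonal nonzero ones, `n` relates all pairs of nonzero states and so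
absorbs the identity. -/
theorem id_eq_zero_of_no_atoms (h : ∀ a : 𝟙_ C ⟶ X, ¬ IsHomAtom a) : 𝟙 X = 0 := by
  obtain ⟨n, hn, hX⟩ := exists_end_complement X
  have hn' {x z : 𝟙_ C ⟶ X} (hx : x ≠ 0) (hz : z ≠ 0) (hxz : x ≫ dagger z = 0) :
      x ≫ n ≫ dagger z ≠ 0 := fun h₀ => by
    have h₁ : x ≫ homAdd (𝟙 X) n ≫ dagger z = 0 := by
      rw [homAdd_comp, comp_homAdd, Category.id_comp, hxz, h₀, homAdd_zero]
    -- The rank one morphism `dagger x ≫ z` lies below `𝟙 X + n` and relates `x` to `z`.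
    rw [← hn (dagger x ≫ z), homAdd_comp, comp_homAdd, homAdd_eq_zero_iff, Category.assoc,
      scalar_eq_id (comp_dagger_self_ne_zero hz), Category.comp_id] at h₁
    exact comp_dagger_self_ne_zero hx h₁.1
  have hsub {b z : 𝟙_ C ⟶ X} (hb : b ≠ 0) (hbz : b ≫ n ≫ dagger z = 0) : HomLE z b := by
    obtain ⟨w, w', rfl, hw, hw'⟩ := exists_split_state z b
    have hw₀ : w' = 0 := not_not.1 fun h₀ => by
      refine hn' hb h₀ (comp_dagger_eq_zero_comm.1 hw') ?_
      rw [← Category.assoc, comp_dagger_eq_zero_comm, homAdd_comp, homAdd_eq_zero_iff] at hbz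
      rw [← Category.assoc, comp_dagger_eq_zero_comm, hbz.2]
    rwa [hw₀, homAdd_zero]
  have hfull {x z : 𝟙_ C ⟶ X} (hx : x ≠ 0) (hz : z ≠ 0) : x ≫ n ≫ dagger z ≠ 0 := fun h₀ => by
    -- If `n` did not relate `x` to `z`, it would relate neither `b` nor `c` to `z`. Then `z` would
    -- lie below both, although they are orthogonal.
    obtain ⟨b, c, hb, hc, hbx, hcx, hcb⟩ := exists_disjoint_of_not_isHomAtom hx (h x)
    have below {w : 𝟙_ C ⟶ X} (hw : w ≠ 0) (hwx : HomLE w x) : HomLE z w := by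
      refine hsub hw ?_
      have := (hwx.comp n).comp (dagger z)
      rwa [Category.assoc, Category.assoc, h₀, HomLE, homAdd_zero] at this
    have hzb : z ≫ dagger b ≠ 0 := by
      rw [Ne, comp_dagger_eq_zero_comm]
      exact homLE_iff.1 (below hb hbx) z (comp_dagger_self_ne_zero hz)
    exact homLE_iff.1 (below hc hcx) b hzb hcb
  refine hX (hom_ext_states fun x => state_ext fun z => ?_)
  rw [comp_homAdd, homAdd_comp, homAdd_eq_zero_iff, Category.comp_id, Category.assoc]
  refine ⟨And.right, fun h₀ => ⟨?_, h₀⟩⟩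
  by_cases hx : x = 0
  · rw [hx, zero_comp]
  by_cases hz : z = 0
  · rw [hz, dagger_zero, comp_zero]
  exact absurd h₀ (hfull hx hz)

/-- An atom of the orthogonal complement of the sum of all atoms would be an atom of `X` orthogonal
to itself. So this complement has no atoms and is zero. -/
theorem exists_atom_comp_dagger_ne_zero {x : 𝟙_ C ⟶ X} (hx : x ≠ 0) :
    ∃ a : 𝟙_ C ⟶ X, IsHomAtom a ∧ a ≫ dagger x ≠ 0 := by
  by_contra! h
  let s := homSum fun a : {a : 𝟙_ C ⟶ X // IsHomAtom a} => a.1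
  obtain ⟨K, k, hk, hm⟩ := IsRelLike.exists_kernel (dagger s)
  have hK : 𝟙 K = 0 := id_eq_zero_of_no_atoms fun a ha => by
    have hak := ha.comp_kernel hk hm
    refine homLE_iff.1 (homLE_homSum
      (fun a : {a : 𝟙_ C ⟶ X // IsHomAtom a} => a.1) ⟨_, hak⟩) _
      (comp_dagger_self_ne_zero hak.1) ?_
    rw [comp_dagger_eq_zero_comm, Category.assoc, hk.1, comp_zero]
  obtain ⟨a, rfl⟩ := hk.exists_fac x (by
    rw [comp_dagger_eq_zero_comm, homSum_comp, homSum_eq_zero_iff]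
    exact fun a => h a.1 a.2)
  rw [← Category.comp_id a, hK, comp_zero, zero_comp] at hx
  exact hx rfl

/-- The identity is the sum of the rank one projections given by the atoms. -/
theorem id_eq_homSum_atoms (X : C) :
    𝟙 X = homSum fun a : {a : 𝟙_ C ⟶ X // IsHomAtom a} => dagger a.1 ≫ a.1 := by
  refine hom_ext_states fun x => state_ext fun z => ?_
  rw [Category.comp_id, comp_homSum, homSum_comp, homSum_eq_zero_iff]
  constructor
  -- An atom not orthogonal to `x` lies below `x`, so it is orthogonal to `z` whenever `x` is.
  · rintro h ⟨a, ha⟩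
    by_cases hxa : x ≫ dagger a = 0
    · rw [← Category.assoc x, hxa, zero_comp, zero_comp]
    · have hxa' : a ≫ dagger x ≠ 0 := fun h' => hxa (comp_dagger_eq_zero_comm.1 h')
      have haz : a ≫ dagger z = 0 := not_not.1 fun h' => homLE_iff.1 (ha.homLE hxa') z h' h
      rw [Category.assoc, Category.assoc, haz, comp_zero, comp_zero]
  · intro h
    -- If the part `w` of `x` below `z` were nonzero, an atom meeting `w` would meet both `x` and
    -- `z`, and its term would not vanish.
    obtain ⟨w, w', rfl, hw, hw'⟩ := exists_split_state x z
    rw [homAdd_comp, hw', homAdd_zero]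
    by_contra hwz
    have hw₀ : w ≠ 0 := fun h₀ => hwz (by rw [h₀, zero_comp])
    obtain ⟨a, ha, haw⟩ := exists_atom_comp_dagger_ne_zero hw₀
    have haz : a ≫ dagger z ≠ 0 := by
      rw [Ne, comp_dagger_eq_zero_comm] at haw ⊢
      exact homLE_iff.1 hw a haw
    have h₁ := h ⟨a, ha⟩
    rw [Category.assoc, Category.assoc, scalar_eq_id haz, Category.comp_id, homAdd_comp,
      homAdd_eq_zero_iff, comp_dagger_eq_zero_comm] at h₁
    exact haw h₁.1

theorem hom_ext_atoms {r s : X ⟶ Y} (h : ∀ (a : 𝟙_ C ⟶ X) (b : 𝟙_ C ⟶ Y), IsHomAtom a →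
    IsHomAtom b → (a ≫ r ≫ dagger b = 0 ↔ a ≫ s ≫ dagger b = 0)) : r = s := by
  have key (t : X ⟶ Y) : t = homSum fun a : {a : 𝟙_ C ⟶ X // IsHomAtom a} =>
      homSum fun b : {b : 𝟙_ C ⟶ Y // IsHomAtom b} =>
        dagger a.1 ≫ (a.1 ≫ t ≫ dagger b.1) ≫ b.1 := by
    conv_lhs => rw [← Category.id_comp t, id_eq_homSum_atoms X, ← Category.comp_id (homSum _ ≫ t),
      id_eq_homSum_atoms Y, homSum_comp, homSum_comp]
    simp only [comp_homSum, Category.assoc]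
  rw [key r, key s]
  simp only [scalar_ext (h _ _ (Subtype.property _) (Subtype.property _))]

/-! ### The functor to sets and relations. -/

variable (C) in
/-- The functor to sets and relations that maps an object to its set of atoms. -/
def atomFunctor : C ⥤ RelCat.{v} where
  obj := (atomPrefunctor C).obj
  map := (atomPrefunctor C).map
  map_id X := by
    apply RelCat.Hom.ext
    ext ⟨a, b⟩
    refine mem_atomPrefunctor_map.trans ?_
    rw [Category.id_comp]
    exact (a.2.comp_dagger_ne_zero_iff b.2).trans Subtype.ext_iff.symm
  map_comp {X Y Z} r s := by
    apply RelCat.Hom.ext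
    ext ⟨a, c⟩
    refine mem_atomPrefunctor_map.trans ?_
    -- Resolving the identity of `Y` into atoms gives a Boolean matrix product; it is nonzero
    -- exactly when some intermediate atom `b` contributes.
    have h : a.1 ≫ (r ≫ s) ≫ dagger c.1 = homSum fun b : {b : 𝟙_ C ⟶ Y // IsHomAtom b} =>
        (a.1 ≫ r ≫ dagger b.1) ≫ b.1 ≫ s ≫ dagger c.1 := by
      conv_lhs => rw [← Category.comp_id r, id_eq_homSum_atoms Y]
      simp only [comp_homSum, homSum_comp, Category.assoc]
    rw [h, Ne, homSum_eq_zero_iff, not_forall]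
    refine exists_congr fun b => ?_
    constructor
    · intro h
      exact ⟨mem_atomPrefunctor_map.2 fun h' => h (by rw [h', zero_comp]),
        mem_atomPrefunctor_map.2 fun h' => h (by rw [h', comp_zero])⟩
    · rintro ⟨h₁, h₂⟩
      rw [show a.1 ≫ r ≫ dagger b.1 = 𝟙 _ from h₁, Category.id_comp]
      exact mem_atomPrefunctor_map.1 h₂

theorem atomFunctor_map_surjective (R : (atomFunctor C).obj X ⟶ (atomFunctor C).obj Y) :
    ∃ r : X ⟶ Y, (atomFunctor C).map r = R := by
  classical
  let S : SetRel {x : 𝟙_ C ⟶ X // IsHomAtom x} {y : 𝟙_ C ⟶ Y // IsHomAtom y} := R.rel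
  -- Each pair of the relation contributes its matrix unit; distinct atoms are orthogonal, so no
  -- other entries appear.
  refine ⟨homSum fun p : {p // p ∈ S} => dagger p.1.1.1 ≫ p.1.2.1, ?_⟩
  apply RelCat.Hom.ext
  ext ⟨a, b⟩
  refine mem_atomPrefunctor_map.trans ?_
  rw [homSum_comp, comp_homSum, Ne, homSum_eq_zero_iff, not_forall]
  constructor
  · rintro ⟨⟨⟨a', b'⟩, hp⟩, h⟩
    have ha : a.1 ≫ dagger a'.1 ≠ 0 := fun h₀ => h (by
      rw [Category.assoc, ← Category.assoc, h₀, zero_comp])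
    have hb : b'.1 ≫ dagger b.1 ≠ 0 := fun h₀ => h (by
      rw [Category.assoc, h₀, comp_zero, comp_zero])
    change (a, b) ∈ S
    rwa [Subtype.ext (a.2.eq_of_comp_dagger_ne_zero a'.2 ha),
      ← Subtype.ext (b'.2.eq_of_comp_dagger_ne_zero b.2 hb)]
  · intro hp
    refine ⟨⟨(a, b), hp⟩, ?_⟩
    rw [Category.assoc, scalar_eq_id (comp_dagger_self_ne_zero b.2.1), Category.comp_id]
    exact comp_dagger_self_ne_zero a.2.1

theorem atomFunctor_map_injective {r s : X ⟶ Y}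
    (h : (atomFunctor C).map r = (atomFunctor C).map s) : r = s := by
  refine hom_ext_atoms fun a b ha hb => not_iff_not.1 ?_
  have h' : (atomPrefunctor C).map r = (atomPrefunctor C).map s := h
  exact (mem_atomPrefunctor_map (x := ⟨a, ha⟩) (y := ⟨b, hb⟩)).symm.trans
    (by rw [h']; exact mem_atomPrefunctor_map)

theorem atomFunctor_map_dagger (r : X ⟶ Y) :
    (atomFunctor C).map (dagger r) = dagger ((atomFunctor C).map r) := by
  apply RelCat.Hom.ext
  ext ⟨a, b⟩
  refine mem_atomPrefunctor_map.trans (Iff.trans ?_ (mem_atomPrefunctor_map (r := r)).symm)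
  rw [Ne, ← dagger_eq_zero_iff, dagger_comp, dagger_comp, dagger_dagger, dagger_dagger,
    Category.assoc]

end Compact

/-- The graph of a bijection is a dagger isomorphism of sets and relations. -/
theorem exists_isDaggerIso_of_bijective {M N : RelCat.{v}} (f : M → N) (hf : Function.Bijective f) :
    ∃ i : M ⟶ N, IsDaggerIso i := by
  refine ⟨RelCat.Hom.ofRel {p : M × N | f p.1 = p.2}, ?_, ?_⟩
  · apply RelCat.Hom.ext
    ext ⟨a, b⟩
    constructor
    · rintro ⟨c, h₁, h₂⟩
      exact hf.1 (Eq.trans h₁ (Eq.symm h₂))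
    · intro h
      exact ⟨f a, rfl, congrArg f (Eq.symm h)⟩
  · apply RelCat.Hom.ext
    ext ⟨a, b⟩
    constructor
    · rintro ⟨c, h₁, h₂⟩
      exact Eq.trans (Eq.symm h₁) h₂
    · intro h
      obtain ⟨c, hc⟩ := hf.2 a
      exact ⟨c, hc, Eq.trans hc h⟩

end DaggerCategory

theorem proposition8 {C : Type u} [Category.{v} C] [MonoidalCategory C] [SymmetricCategory C]
    [DaggerCategory C] [DaggerCategory.DaggerCompactClosed C] [HasZeroMorphisms C]
    [DaggerCategory.HasDaggerBiproducts C]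
    (exists_kernel : ∀ {X Y : C} (f : X ⟶ Y), ∃ (K : C) (k : K ⟶ X),
      DaggerCategory.IsKernelOf k f ∧ DaggerCategory.IsDaggerMono k)
    (jointlyEpic : ∀ {K K' X : C} (k : K ⟶ X) (k' : K' ⟶ X), DaggerCategory.IsDaggerKernel k →
      DaggerCategory.IsComplementOf k' k → DaggerCategory.JointlyEpic k k')
    (unit_nonzero : ¬ IsZero (𝟙_ C))
    (isIso_of_ne_zero : ∀ f : 𝟙_ C ⟶ 𝟙_ C, f ≠ 0 → IsIso f)
    (unit_separator : IsSeparator (𝟙_ C)) :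
    ∃ E : C ⥤ RelCat.{v}, E.toPrefunctor = DaggerCategory.atomPrefunctor C ∧
      DaggerCategory.IsDaggerEquivalence E ∧
      ∀ (M : RelCat.{v}) (A : DaggerCategory.DaggerBiproduct (fun _ : M => 𝟙_ C)),
        ∃ i : M ⟶ E.obj A.pt, DaggerCategory.IsDaggerIso i := by
  have : DaggerCategory.IsRelLike C :=
    ⟨exists_kernel, jointlyEpic, unit_nonzero, isIso_of_ne_zero, unit_separator⟩
  have iso (M : RelCat.{v}) (A : DaggerCategory.DaggerBiproduct (fun _ : M => 𝟙_ C)) :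
      ∃ i : M ⟶ (DaggerCategory.atomFunctor C).obj A.pt, DaggerCategory.IsDaggerIso i :=
    DaggerCategory.exists_isDaggerIso_of_bijective _ A.bijective_ι
  refine ⟨DaggerCategory.atomFunctor C, rfl, ⟨⟨DaggerCategory.atomFunctor_map_surjective⟩,
    ⟨DaggerCategory.atomFunctor_map_injective⟩, DaggerCategory.atomFunctor_map_dagger,
    fun M => ⟨_, iso M (DaggerCategory.chosenBiproduct _)⟩⟩, iso⟩
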